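/- Let $S$ be a closed surface with a finite cellular decomposition $\Sigma=(V,E,F)$, in which every 2-cell has at least one 1-cell in its boundary, and let $\Phi\colon E\to(0,\tfrac{\pi}{2})$ be a weight. Given radii $\mathbf r\in(0,\tfrac{\pi}{2})^{F}$, take for each $e\in E$ two disks in the unit sphere $\mathbb S^2$ whose radii are those of the two 2-cells on the sides of $e$ (which may coincide), placed so that their intersection is a bigon $B_e$ with interior angle $\Phi(e)$; such a pair of disks is unique up to isometry. Let $Q(e)$ be the spherical quadrilateral spanned by the two centers and the two vertices of $B_e$. Gluing the quadrilaterals $Q(e)$ along their sides, according to the triangulation of $S$ obtained by joining an auxiliary point of each 2-cell to the vertices on its boundary, gives a spherical conical metric $\mu$ on $S$ together with a circle pattern $\mathcal P$, whose disks are centered at the auxiliary points and have radii $\mathbf r$. A circle pattern metric on $S$ (realizing $(\Sigma,\Phi)$) is a pair $(\mu,\mathcal P)$ arising in this way, for some $\mathbf r\in(0,\tfrac{\pi}{2})^F$, from a cellular decomposition isotopic to $\Sigma$. Two circle pattern metrics are the same up to isometry if there is an isometry between them that is isotopic to the identity of $S$ and carries the disks of one pattern to the corresponding disks of the other. For $f\in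 F$, the total geodesic curvature $L_f$ is the sum of $\ell\cdot\cot r_f$ over all sides of 1-cells that face $f$ (a 1-cell with $f$ on both sides counts twice), where $\ell$ is the length of the corresponding side of the bigon $B_e$, that is, of the arc of the boundary circle of the disk of $f$ that lies in the other disk. For $F'\subset F$ let $E_{F'}$ be the set of 1-cells in the boundary of some 2-cell of $F'$, and let $$\mathcal L_1=\Big\{(L_f)_{f\in F}\in\mathbb R_{>0}^{F}\ \Big|\ \sum_{f\in F'}L_f<2\sum_{e\in E_{F'}}\Phi(e)\ \text{ for every nonempty } F'\subset F\Big\}.$$ Then, for every $\hat L\in\mathbb R^{F}$, there exists a circle pattern metric on $S$ with total geodesic curvature $\hat L$ if and only if $\hat L\in\mathcal L_1$. Moreover, the circle pattern metric with total geodesic curvature $\hat L$ is unique up to isometry if it exists. -/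

import Mathlib

open Real Set

noncomputable section

namespace CirclePattern

/-! ### Two disks on the unit sphere -/

/-- The point of the unit sphere at spherical distance `r` from the north pole `(0, 0, 1)`, in the
direction of azimuth `τ`. For fixed `r`, it runs once through the circle of spherical radius `r`
about the north pole as `τ` runs through `(-π, π]`, with constant speed `sin r`. -/
def circlePoint (r τ : ℝ) : EuclideanSpace ℝ (Fin 3) :=
  !₂[sin r * cos τ, sin r * sin τ, cos r]

/-- The north pole. -/
def northPole : EuclideanSpace ℝ (Fin 3) := !₂[0, 0, 1]

/-- The open disk of spherical radius `r` about the point `c` of the unit sphere; the spherical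
distance of two points of the unit sphere is the angle between them. -/
def sphericalDisk (c : EuclideanSpace ℝ (Fin 3)) (r : ℝ) : Set (EuclideanSpace ℝ (Fin 3)) :=
  {x | ‖x‖ = 1 ∧ InnerProductGeometry.angle c x < r}

/-- The distance between the centers of two disks of radii `r₁`, `r₂` whose intersection is a bigon
of interior angle `φ`: at a vertex of the bigon, the radii towards the two centers make the angle
`π - φ`, and the distance is given by the spherical law of cosines. -/
def centerDist (r₁ r₂ φ : ℝ) : ℝ :=
  arccos (cos r₁ * cos r₂ + sin r₁ * sin r₂ * cos (π - φ))

/-- The disk `D₂` of radius `r₂` that meets the disk `D₁` of radius `r₁` about the north pole with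
intersection angle `φ`; its center is put at azimuth `0`. -/
def secondDisk (r₁ r₂ φ : ℝ) : Set (EuclideanSpace ℝ (Fin 3)) :=
  sphericalDisk (circlePoint (centerDist r₁ r₂ φ) 0) r₂

/-- The angle, seen from the center of `D₁`, of the side `∂D₁ ∩ D₂` of the bigon `D₁ ∩ D₂`. -/
def centralAngle (r₁ r₂ φ : ℝ) : ℝ :=
  (MeasureTheory.volume {τ : ℝ | τ ∈ Ioc (-π) π ∧ circlePoint r₁ τ ∈ secondDisk r₁ r₂ φ}).toReal

/-- The length of the side `∂D₁ ∩ D₂` of the bigon `D₁ ∩ D₂`. -/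
def bigonSideLength (r₁ r₂ φ : ℝ) : ℝ := centralAngle r₁ r₂ φ * sin r₁

/-- The three vertices of the spherical triangle spanned by the center of `D₁` (vertex `0`) and by
the two vertices of the bigon `D₁ ∩ D₂` (vertices `1` and `2`, the end points of the side
`∂D₁ ∩ D₂`). Together with the corresponding triangle at the center of `D₂` it forms the spherical
quadrilateral of the two disks. -/
def triangleVertex (r₁ r₂ φ : ℝ) : Fin 3 → EuclideanSpace ℝ (Fin 3) :=
  ![northPole, circlePoint r₁ (-(centralAngle r₁ r₂ φ / 2)),
    circlePoint r₁ (centralAngle r₁ r₂ φ / 2)]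

/-! ### Cellular decompositions -/

/-- The combinatorial part of a cellular decomposition of a closed surface: polygons, whose sides
are glued in pairs. `E` is the set of 1-cells and `F` the set of 2-cells. Every 1-cell `e` has two
sides `(e, false)` and `(e, true)`; `face s` is the 2-cell on that side (the two may coincide), and
`next` is the cyclic order of the sides in the boundary of each 2-cell. The cyclic orders orient the
2-cells; `twisted e` says that the two sides of `e` run through `e` in the same direction (so the
surface need not be orientable). The 0-cells are the classes of corners of the polygons. -/
structure CellData (E F : Type*) where
  face : E × Bool → F
  face_surjective : Function.Surjective face
  next : Equiv.Perm (E × Bool)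
  face_eq_iff : ∀ s s', face s = face s' ↔ next.SameCycle s s'
  twisted : E → Prop

namespace CellData

variable {E F : Type*} (C : CellData E F)

/-- The other side of the same 1-cell. -/
def opposite (s : E × Bool) : E × Bool := (s.1, !s.2)

/-- The gluing of triangles. A 2-cell with an auxiliary point inside it is cut into one triangle for
each of its sides `s`: vertex `0` is the auxiliary point, and vertices `1`, `2` are the initial and
the terminal point of the side. Points of the triangle are given by barycentric coordinates. -/
inductive Glue : (Σ _ : E × Bool, stdSimplex ℝ (Fin 3)) → (Σ _ : E × Bool, stdSimplex ℝ (Fin 3)) →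
    Prop
  /-- consecutive triangles of a 2-cell share the segment from the auxiliary point to a corner -/
  | spoke (s : E × Bool) (x y : stdSimplex ℝ (Fin 3)) (hx : x.1 1 = 0) (hy : y.1 2 = 0)
      (h₀ : x.1 0 = y.1 0) (h : x.1 2 = y.1 1) : Glue ⟨s, x⟩ ⟨C.next s, y⟩
  | edge (e : E) (he : ¬ C.twisted e) (x y : stdSimplex ℝ (Fin 3)) (hx : x.1 0 = 0) (hy : y.1 0 = 0)
      (h₁ : x.1 1 = y.1 2) (h₂ : x.1 2 = y.1 1) : Glue ⟨(e, false), x⟩ ⟨(e, true), y⟩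
  | twistedEdge (e : E) (he : C.twisted e) (x y : stdSimplex ℝ (Fin 3)) (hx : x.1 0 = 0)
      (hy : y.1 0 = 0) (h₁ : x.1 1 = y.1 1) (h₂ : x.1 2 = y.1 2) :
      Glue ⟨(e, false), x⟩ ⟨(e, true), y⟩

/-- The closed surface obtained by the gluing, with the quotient topology. -/
def Realization : Type _ := Quot C.Glue

instance : TopologicalSpace C.Realization :=
  inferInstanceAs (TopologicalSpace (Quot C.Glue))

/-- The point with barycentric coordinates `x` of the triangle at the side `s`. -/
def point (s : E × Bool) (x : stdSimplex ℝ (Fin 3)) : C.Realization := Quot.mk C.Glue ⟨s, x⟩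

/-- The auxiliary point of the 2-cell on the side `s`. -/
def center (s : E × Bool) : C.Realization := C.point s ⟨Pi.single 0 1, single_mem_stdSimplex ℝ 0⟩

/-- For radii `r` and weight `Φ`, the triangle at the side `s` becomes a spherical triangle: the half
that belongs to the 2-cell `face s` of the spherical quadrilateral of two disks with the radii of
the two adjacent 2-cells and with intersection angle `Φ`. The point with barycentric coordinates `x`
is the radial projection to the unit sphere of the vector given here. -/
def trianglePoint (Φ : E → ℝ) (r : F → ℝ) (s : E × Bool) (x : stdSimplex ℝ (Fin 3)) :
    EuclideanSpace ℝ (Fin 3) :=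
  ∑ i, x.1 i • triangleVertex (r (C.face s)) (r (C.face (opposite s))) (Φ s.1) i

/-- `BrokenGeodesic Φ r p q ℓ`: there is a path of length `ℓ` from `p` to `q` which consists of
finitely many geodesic segments, each of them inside one of the spherical triangles. (The spherical
distance of the radial projections of two vectors is the angle between the vectors.) -/
inductive BrokenGeodesic (Φ : E → ℝ) (r : F → ℝ) : C.Realization → C.Realization → ℝ → Prop
  | refl (p : C.Realization) : BrokenGeodesic Φ r p p 0
  | cons (s : E × Bool) (x y : stdSimplex ℝ (Fin 3)) (q : C.Realization) (ℓ : ℝ)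
      (h : BrokenGeodesic Φ r (C.point s y) q ℓ) :
      BrokenGeodesic Φ r (C.point s x) q
        (InnerProductGeometry.angle (C.trianglePoint Φ r s x) (C.trianglePoint Φ r s y) + ℓ)

/-- The distance of the spherical conical metric obtained by gluing the spherical triangles, i.e. the
infimum of the lengths of the broken geodesics (`∞` between different components). -/
def gluedDist (Φ : E → ℝ) (r : F → ℝ) (p q : C.Realization) : ENNReal :=
  ⨅ (ℓ : ℝ) (_ : C.BrokenGeodesic Φ r p q ℓ), ENNReal.ofReal ℓ

/-- The total geodesic curvature of the 2-cell `f`: the sum, over the sides in its boundary, of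
length times geodesic curvature `cot r_f` of the corresponding side of the bigon. -/
def totalGeodesicCurvature [Fintype E] (Φ : E → ℝ) (r : F → ℝ) (f : F) : ℝ :=
  open Classical in
  ∑ s : E × Bool with C.face s = f,
    bigonSideLength (r (C.face s)) (r (C.face (opposite s))) (Φ s.1) * cot (r (C.face s))

/-- `E_{F'}`, the set of 1-cells in the boundary of some 2-cell in `F'`. -/
def edgesOf [Fintype E] (F' : Finset F) : Finset E :=
  open Classical in
  Finset.univ.filter fun e => ∃ b : Bool, C.face (e, b) ∈ F'

/-- The set `𝓛₁` of positive vectors with `∑_{f ∈ F'} L_f < 2 ∑_{e ∈ E_{F'}} Φ(e)` for every nonempty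
set `F'` of 2-cells. -/
def admissible [Fintype E] (Φ : E → ℝ) : Set (F → ℝ) :=
  {L | (∀ f, 0 < L f) ∧
    ∀ F' : Finset F, F'.Nonempty → ∑ f ∈ F', L f < 2 * ∑ e ∈ C.edgesOf F', Φ e}

end CellData

/-- A cellular decomposition of the space `S`, with 1-cells `E` and 2-cells `F`: `S` is identified
with the surface that arises from polygons by gluing their sides in pairs. (If `E` is finite, such an
`S` is a closed surface.) -/
structure CellularDecomposition (S E F : Type*) [TopologicalSpace S] extends CellData E F where
  homeo : toCellData.Realization ≃ₜ S

/-- Two homeomorphisms are isotopic if they are joined by a continuous family of homeomorphisms. -/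
def Isotopic {X Y : Type*} [TopologicalSpace X] [TopologicalSpace Y] (g h : X ≃ₜ Y) : Prop :=
  ∃ H : unitInterval → (X ≃ₜ Y),
    Continuous (fun p : unitInterval × X => H p.1 p.2) ∧ H 0 = g ∧ H 1 = h

/-- A circle pattern metric on `S` which realizes the weighted cellular decomposition `(Σ, Φ)`: a
distance function on `S` that is, through a cellular decomposition `marking` isotopic to the given
one, the spherical conical metric glued from the spherical quadrilaterals for radii in `(0, π/2)`.
The disks of the circle pattern are those with the radii `radius f`, centered at the auxiliary points
of the 2-cells. -/
structure CirclePatternMetric {S E F : Type*} [TopologicalSpace S]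
    (C : CellularDecomposition S E F) (Φ : E → ℝ) where
  dist : S → S → ENNReal
  radius : F → ℝ
  radius_mem : ∀ f, radius f ∈ Ioo 0 (π / 2)
  marking : C.toCellData.Realization ≃ₜ S
  isotopic : Isotopic marking C.homeo
  dist_eq : ∀ p q, dist (marking p) (marking q) = C.toCellData.gluedDist Φ radius p q

namespace CirclePatternMetric

variable {S E F : Type*} [TopologicalSpace S] {C : CellularDecomposition S E F} {Φ : E → ℝ}

/-- The vector of total geodesic curvatures of a circle pattern metric. -/
def totalGeodesicCurvature [Fintype E] (μ : CirclePatternMetric C Φ) : F → ℝ :=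
  C.toCellData.totalGeodesicCurvature Φ μ.radius

/-- `μ₁` and `μ₂` agree up to isometry: there is an isometry of `S` from `μ₁` to `μ₂`, isotopic to the
identity, which carries the disks of the circle pattern of `μ₁` (given by center and radius) to those
of `μ₂`. -/
def IsIsometric (μ₁ μ₂ : CirclePatternMetric C Φ) : Prop :=
  ∃ g : S ≃ₜ S, Isotopic g (Homeomorph.refl S) ∧
    (∀ x y, μ₂.dist (g x) (g y) = μ₁.dist x y) ∧
    (∀ s : E × Bool, g (μ₁.marking (C.toCellData.center s)) =
      μ₂.marking (C.toCellData.center s)) ∧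
    ∀ f, μ₁.radius f = μ₂.radius f

end CirclePatternMetric

end CirclePattern

end

/-!
Write `L₁ = ℓ₁ cot r₁` and `L₂ = ℓ₂ cot r₂` for the total geodesic curvatures of the two sides of a
bigon of interior angle `φ`. By Gauss-Bonnet `L₁ + L₂` is `2 * φ` minus the area of the bigon, so it
is less than `2 * φ`, strictly decreasing in both radii, and tends to `2 * φ` as both disks shrink
to points. If only the first disk shrinks to a point, then `L₁` alone tends to `2 * φ`. Moreover
`L₁` increases with `r₂`.

The bound by `2 * φ` makes the total geodesic curvatures of a circle pattern admissible. The two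
monotonicities give a comparison principle: if the curvatures for `r` are at most those for `r'`,
then `r' ≤ r`, since otherwise passing from `r'` to `r ⊓ r'` would raise no single curvature but
raise their sum. Hence the radii are unique. For existence, Perron's method takes the smallest
radii in `(0, π / 2]` whose curvatures are at most `L`; the limits for shrinking disks and the
inequalities defining `admissible` keep these radii away from `0`.
-/

open Filter Topology

namespace CirclePattern

section OffDiagonal

variable {ι α β : Type*}

/-- `T` is off-diagonally increasing on `s`: its `i`-th component increases when coordinates other
than the `i`-th are raised. (The negative of such a map is called off-diagonally antitone in the
theory of M-functions.) -/
def OffDiagMonotoneOn [Preorder α] [Preorder β] (T : (ι → α) → ι → β) (s : Set (ι → α)) : Prop :=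
  ∀ ⦃x⦄, x ∈ s → ∀ ⦃y⦄, y ∈ s → x ≤ y → ∀ i, x i = y i → T x i ≤ T y i

namespace OffDiagMonotoneOn

lemma le_of_apply_le [Fintype ι] [LinearOrder α] [AddCommMonoid β] [PartialOrder β]
    [IsOrderedAddMonoid β] {T : (ι → α) → ι → β} {s : Set (ι → α)} (hT : OffDiagMonotoneOn T s)
    (hs : InfClosed s) (hsum : StrictAntiOn (fun x => ∑ i, T x i) s) {x y : ι → α} (hx : x ∈ s)
    (hy : y ∈ s) (h : T x ≤ T y) : y ≤ x := by
  have hinf : x ⊓ y ∈ s := hs hx hy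
  have hTinf : T (x ⊓ y) ≤ T y := by
    intro i
    rcases le_total (x i) (y i) with hi | hi
    · exact (hT hinf hx inf_le_left i (inf_eq_left.2 hi)).trans (h i)
    · exact hT hinf hy inf_le_right i (inf_eq_right.2 hi)
  by_contra hxy
  have hlt : x ⊓ y < y := inf_lt_right.2 hxy
  exact (Finset.sum_le_sum fun i _ => hTinf i).not_gt (hsum hinf hy hlt)

lemma injOn [Fintype ι] [LinearOrder α] [AddCommMonoid β] [PartialOrder β]
    [IsOrderedAddMonoid β] {T : (ι → α) → ι → β} {s : Set (ι → α)} (hT : OffDiagMonotoneOn T s)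
    (hs : InfClosed s) (hsum : StrictAntiOn (fun x => ∑ i, T x i) s) : InjOn T s :=
  fun _ hx _ hy h =>
    (hT.le_of_apply_le hs hsum hy hx h.ge).antisymm (hT.le_of_apply_le hs hsum hx hy h.le)

/-- Perron's method: a subsolution with minimal sum of coordinates is a solution, since lowering a
single coordinate lowers the other components of `T`. -/
lemma exists_apply_eq [Finite ι] [LinearOrder β] [TopologicalSpace β] [OrderClosedTopology β]
    {T : (ι → ℝ) → ι → β} {a b : ι → ℝ} {L : ι → β}
    (hT : OffDiagMonotoneOn T (univ.pi fun i => Ioc (a i) (b i)))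
    (hcont : ContinuousOn T (univ.pi fun i => Ioc (a i) (b i)))
    (hcomp : IsCompact {x ∈ univ.pi fun i => Ioc (a i) (b i) | T x ≤ L})
    (hne : {x ∈ univ.pi fun i => Ioc (a i) (b i) | T x ≤ L}.Nonempty) :
    ∃ x ∈ univ.pi fun i => Ioc (a i) (b i), T x = L := by
  classical
  have := Fintype.ofFinite ι
  obtain ⟨x, ⟨hx, hxL⟩, hmin⟩ := hcomp.exists_isMinOn hne (f := fun x => ∑ i, x i) (by fun_prop)
  refine ⟨x, hx, funext fun i => (hxL i).antisymm ?_⟩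
  by_contra! hlt
  have hmem : ∀ t ∈ Ioo (a i) (x i), Function.update x i t ∈ univ.pi fun i => Ioc (a i) (b i) :=
    fun t ht => (update_mem_pi_iff_of_mem hx).2 fun _ => ⟨ht.1, ht.2.le.trans (hx i trivial).2⟩
  have htend : Tendsto (Function.update x i) (𝓝[<] x i)
      (𝓝[univ.pi fun i => Ioc (a i) (b i)] x) := by
    refine tendsto_nhdsWithin_iff.2 ⟨?_, ?_⟩
    · have hcts : Continuous (Function.update x i) := by fun_prop
      simpa only [Function.update_eq_self] using (hcts.tendsto (x i)).mono_left nhdsWithin_le_nhds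
    · filter_upwards [Ioo_mem_nhdsLT (hx i trivial).1] using hmem
  have hlower : ∀ᶠ t in 𝓝[<] x i, T (Function.update x i t) i < L i :=
    (((continuousOn_pi.1 hcont i) x hx).tendsto.comp htend).eventually_lt_const hlt
  obtain ⟨t, htL, ht⟩ := (hlower.and (Ioo_mem_nhdsLT (hx i trivial).1)).exists
  have hle : Function.update x i t ≤ x := update_le_self_iff.2 ht.2.le
  have hsub : T (Function.update x i t) ≤ L := by
    intro j
    rcases eq_or_ne j i with rfl | hj
    · exact htL.le
    · exact (hT (hmem t ht) hx hle j (Function.update_of_ne hj _ _)).trans (hxL j)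
  exact (isMinOn_iff.1 hmin _ ⟨hmem t ht, hsub⟩).not_gt <|
    Finset.sum_lt_sum (fun j _ => hle j) ⟨i, Finset.mem_univ i, by simpa using ht.2⟩

end OffDiagMonotoneOn

end OffDiagonal

section Bigon

/-- The cotangent of half the angle which a side of a bigon of interior angle `φ` subtends at the
center of its circle, of radius `r₁`; `r₂` is the radius of the other circle. This is the cotangent
four-part formula in the triangle of the two centers and a vertex of the bigon. -/
noncomputable def cotHalfAngle (r₁ r₂ φ : ℝ) : ℝ :=
  (sin r₁ * cot r₂ + cos r₁ * cos φ) / sin φ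

/-- The angle in `(0, π)` with cotangent `cotHalfAngle r₁ r₂ φ`. -/
noncomputable def halfAngle (r₁ r₂ φ : ℝ) : ℝ := π / 2 - arctan (cotHalfAngle r₁ r₂ φ)

/-- The total geodesic curvature of the side on the circle of radius `r₁` of a bigon of interior
angle `φ`, in closed form: the length `2 * halfAngle r₁ r₂ φ * sin r₁` times `cot r₁`. -/
noncomputable def arcCurvature (r₁ r₂ φ : ℝ) : ℝ := 2 * halfAngle r₁ r₂ φ * cos r₁

variable {r r₁ r₂ φ : ℝ}

lemma halfAngle_pos (r₁ r₂ φ : ℝ) : 0 < halfAngle r₁ r₂ φ := sub_pos.2 (arctan_lt_pi_div_two _)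

lemma halfAngle_lt_pi (r₁ r₂ φ : ℝ) : halfAngle r₁ r₂ φ < π := by
  unfold halfAngle
  linarith [neg_pi_div_two_lt_arctan (cotHalfAngle r₁ r₂ φ)]

lemma cos_halfAngle (r₁ r₂ φ : ℝ) :
    cos (halfAngle r₁ r₂ φ) = cotHalfAngle r₁ r₂ φ / √(1 + cotHalfAngle r₁ r₂ φ ^ 2) := by
  rw [halfAngle, cos_pi_div_two_sub, sin_arctan]

lemma sin_halfAngle (r₁ r₂ φ : ℝ) :
    sin (halfAngle r₁ r₂ φ) = 1 / √(1 + cotHalfAngle r₁ r₂ φ ^ 2) := by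
  rw [halfAngle, sin_pi_div_two_sub, cos_arctan]

lemma pi_div_two_sub_arctan_cot {x : ℝ} (hx : x ∈ Ioo 0 π) : π / 2 - arctan (cot x) = x := by
  rw [cot_eq_cos_div_sin, ← sin_pi_div_two_sub x, ← cos_pi_div_two_sub x, ← tan_eq_sin_div_cos,
    arctan_tan (by linarith [hx.2]) (by linarith [hx.1]), sub_sub_cancel]

lemma arcCurvature_pos (hr : r₁ ∈ Ioo 0 (π / 2)) : 0 < arcCurvature r₁ r₂ φ := by
  have hcos : 0 < cos r₁ := cos_pos_of_mem_Ioo ⟨by linarith [hr.1, pi_pos], hr.2⟩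
  have := halfAngle_pos r₁ r₂ φ
  unfold arcCurvature
  positivity

lemma arcCurvature_pi_div_two (r₂ φ : ℝ) : arcCurvature (π / 2) r₂ φ = 0 := by
  simp only [arcCurvature, cos_pi_div_two, mul_zero]

lemma arcCurvature_zero_left (r₂ : ℝ) (hφ : φ ∈ Ioo 0 π) : arcCurvature 0 r₂ φ = 2 * φ := by
  simp only [arcCurvature, halfAngle, cotHalfAngle, sin_zero, cos_zero, zero_mul, zero_add, one_mul,
    mul_one, ← cot_eq_cos_div_sin, pi_div_two_sub_arctan_cot hφ]

lemma hasDerivAt_cot (hr : sin r ≠ 0) : HasDerivAt cot (-1 / sin r ^ 2) r := by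
  have h := (hasDerivAt_cos r).div (hasDerivAt_sin r) hr
  rw [show cot = cos / sin from funext cot_eq_cos_div_sin]
  exact h.congr_deriv (by rw [← sin_sq_add_cos_sq r]; ring)

lemma cot_strictAntiOn : StrictAntiOn cot (Ioo 0 π) := by
  have hsin : ∀ r ∈ Ioo 0 π, sin r ≠ 0 := fun r hr => (sin_pos_of_mem_Ioo hr).ne'
  refine strictAntiOn_of_deriv_neg (convex_Ioo 0 π)
    (fun r hr => (hasDerivAt_cot (hsin r hr)).continuousAt.continuousWithinAt) fun r hr => ?_
  rw [interior_Ioo] at hr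
  rw [(hasDerivAt_cot (hsin r hr)).deriv]
  exact div_neg_of_neg_of_pos (by norm_num) (pow_pos (sin_pos_of_mem_Ioo hr) 2)

lemma continuousAt_arcCurvature (r₁ φ : ℝ) (hr₂ : sin r₂ ≠ 0) :
    ContinuousAt (fun p : ℝ × ℝ => arcCurvature p.1 p.2 φ) (r₁, r₂) := by
  have hcot : ContinuousAt (fun p : ℝ × ℝ => cot p.2) (r₁, r₂) :=
    (hasDerivAt_cot hr₂).continuousAt.comp_of_eq continuousAt_snd rfl
  unfold arcCurvature halfAngle cotHalfAngle
  fun_prop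

lemma arcCurvature_monotoneOn_right (hφ : φ ∈ Ioo 0 π) (hr₁ : r₁ ∈ Icc 0 (π / 2)) :
    MonotoneOn (fun r₂ => arcCurvature r₁ r₂ φ) (Ioo 0 π) := by
  intro r₂ hr₂ r₂' hr₂' hle
  have hcot : cot r₂' ≤ cot r₂ := cot_strictAntiOn.antitoneOn hr₂ hr₂' hle
  have hφ_sin := sin_pos_of_mem_Ioo hφ
  have hsin : 0 ≤ sin r₁ := sin_nonneg_of_mem_Icc ⟨hr₁.1, by linarith [hr₁.2, pi_pos]⟩
  have hcos : 0 ≤ cos r₁ := cos_nonneg_of_mem_Icc ⟨by linarith [hr₁.1, pi_pos], hr₁.2⟩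
  simp only [arcCurvature, halfAngle, cotHalfAngle]
  gcongr

/-- By the spherical law of cosines, both sides are the squared sine of the distance of the centers;
the right side is visibly symmetric in the two radii. -/
lemma sq_mul_one_add_cotHalfAngle_sq (r₁ : ℝ) (hr₂ : sin r₂ ≠ 0) (hφ : sin φ ≠ 0) :
    (sin r₂ * sin φ) ^ 2 * (1 + cotHalfAngle r₁ r₂ φ ^ 2) =
      1 - (cos r₁ * cos r₂ - sin r₁ * sin r₂ * cos φ) ^ 2 := by
  rw [cotHalfAngle, cot_eq_cos_div_sin]
  field_simp
  linear_combination sin r₂ ^ 2 * sin_sq_add_cos_sq φ + sin_sq_add_cos_sq r₂ +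
    (sin r₂ ^ 2 * cos φ ^ 2 + cos r₂ ^ 2) * sin_sq_add_cos_sq r₁

lemma hasDerivAt_halfAngle_left (r₁ r₂ φ : ℝ) :
    HasDerivAt (fun r => halfAngle r r₂ φ)
      (-((cos r₁ * cot r₂ - sin r₁ * cos φ) / sin φ / (1 + cotHalfAngle r₁ r₂ φ ^ 2))) r₁ := by
  have hcot : HasDerivAt (fun r => cotHalfAngle r r₂ φ)
      ((cos r₁ * cot r₂ + -sin r₁ * cos φ) / sin φ) r₁ :=
    (((hasDerivAt_sin r₁).mul_const _).add ((hasDerivAt_cos r₁).mul_const _)).div_const _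
  exact (hcot.arctan.const_sub (π / 2)).congr_deriv (by ring)

lemma hasDerivAt_halfAngle_right (r₁ : ℝ) (hr₂ : sin r₂ ≠ 0) (hφ : sin φ ≠ 0) :
    HasDerivAt (fun r => halfAngle r₁ r φ)
      (sin r₁ * sin φ / (1 - (cos r₁ * cos r₂ - sin r₁ * sin r₂ * cos φ) ^ 2)) r₂ := by
  have hcot : HasDerivAt (fun r => cotHalfAngle r₁ r φ)
      (sin r₁ * (-1 / sin r₂ ^ 2) / sin φ) r₂ :=
    (((hasDerivAt_cot hr₂).const_mul _).add_const _).div_const _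
  refine (hcot.arctan.const_sub (π / 2)).congr_deriv ?_
  rw [← sq_mul_one_add_cotHalfAngle_sq r₁ hr₂ hφ]
  field_simp

lemma sin_mul_cos_halfAngle (r₁ r₂ φ : ℝ) :
    sin (halfAngle r₁ r₂ φ) * cos (halfAngle r₁ r₂ φ) =
      cotHalfAngle r₁ r₂ φ / (1 + cotHalfAngle r₁ r₂ φ ^ 2) := by
  rw [sin_halfAngle, cos_halfAngle, div_mul_div_comm, one_mul, mul_self_sqrt (by positivity)]

/-- By Gauss-Bonnet, the sum of the curvatures of the two sides of a bigon is `2 * φ` minus its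
area, so up to sign this is the growth rate of the area with `r₁`. -/
lemma hasDerivAt_arcCurvature_add (hr₁ : sin r₁ ≠ 0) (hr₂ : sin r₂ ≠ 0) (hφ : sin φ ≠ 0) :
    HasDerivAt (fun r => arcCurvature r r₂ φ + arcCurvature r₂ r φ)
      (-(2 * sin r₁ * (halfAngle r₁ r₂ φ -
        sin (halfAngle r₁ r₂ φ) * cos (halfAngle r₁ r₂ φ)))) r₁ := by
  have hderiv := ((((hasDerivAt_halfAngle_left r₁ r₂ φ).const_mul 2).mul (hasDerivAt_cos r₁)).add
    (((hasDerivAt_halfAngle_right r₂ hr₁ hφ).const_mul 2).mul_const (cos r₂)))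
  refine hderiv.congr_deriv ?_
  have hsymm : 1 - (cos r₂ * cos r₁ - sin r₂ * sin r₁ * cos φ) ^ 2 =
      (sin r₂ * sin φ) ^ 2 * (1 + cotHalfAngle r₁ r₂ φ ^ 2) := by
    rw [sq_mul_one_add_cotHalfAngle_sq r₁ hr₂ hφ]
    ring
  have hne : 1 + cotHalfAngle r₁ r₂ φ ^ 2 ≠ 0 := by positivity
  have hcross : sin r₁ * cotHalfAngle r₁ r₂ φ =
      cos r₂ / (sin r₂ * sin φ) - cos r₁ * (cos r₁ * cot r₂ - sin r₁ * cos φ) / sin φ := by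
    rw [cotHalfAngle, cot_eq_cos_div_sin]
    field_simp
    linear_combination cos r₂ * sin_sq_add_cos_sq r₁
  have hright : sin r₂ * sin φ / (1 - (cos r₂ * cos r₁ - sin r₂ * sin r₁ * cos φ) ^ 2) * cos r₂ =
      cos r₂ / (sin r₂ * sin φ) / (1 + cotHalfAngle r₁ r₂ φ ^ 2) := by
    rw [hsymm]
    field_simp
  rw [sin_mul_cos_halfAngle]
  linear_combination 2 * hright - 2 / (1 + cotHalfAngle r₁ r₂ φ ^ 2) * hcross

lemma sin_mul_cos_lt_self {x : ℝ} (hx : 0 < x) : sin x * cos x < x := by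
  have := sin_lt (mul_pos two_pos hx)
  rw [sin_two_mul] at this
  linarith

lemma strictAntiOn_arcCurvature_add_left (hr₂ : r₂ ∈ Ioo 0 π) (hφ : φ ∈ Ioo 0 π) :
    StrictAntiOn (fun r => arcCurvature r r₂ φ + arcCurvature r₂ r φ) (Ioo 0 π) := by
  have hderiv : ∀ r ∈ Ioo 0 π,
      HasDerivAt (fun r => arcCurvature r r₂ φ + arcCurvature r₂ r φ) _ r :=
    fun r hr => hasDerivAt_arcCurvature_add (sin_pos_of_mem_Ioo hr).ne' (sin_pos_of_mem_Ioo hr₂).ne'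
      (sin_pos_of_mem_Ioo hφ).ne'
  refine strictAntiOn_of_deriv_neg (convex_Ioo 0 π)
    (fun r hr => (hderiv r hr).continuousAt.continuousWithinAt) fun r hr => ?_
  rw [interior_Ioo] at hr
  rw [(hderiv r hr).deriv]
  have hsin := sin_pos_of_mem_Ioo hr
  have harea := sub_pos.2 (sin_mul_cos_lt_self (halfAngle_pos r r₂ φ))
  exact neg_neg_of_pos (by positivity)

lemma strictAntiOn_arcCurvature_add (hφ : φ ∈ Ioo 0 π) :
    StrictAntiOn (fun p : ℝ × ℝ => arcCurvature p.1 p.2 φ + arcCurvature p.2 p.1 φ)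
      (Ioo 0 π ×ˢ Ioo 0 π) := by
  rintro ⟨r₁, r₂⟩ ⟨hr₁, hr₂⟩ ⟨r₁', r₂'⟩ ⟨hr₁', hr₂'⟩ hlt
  have hle := Prod.mk_le_mk.1 hlt.le
  have hfst := strictAntiOn_arcCurvature_add_left hr₂ hφ
  have hsnd := strictAntiOn_arcCurvature_add_left hr₁' hφ
  rcases hle.1.lt_or_eq with h₁ | rfl
  · calc arcCurvature r₁' r₂' φ + arcCurvature r₂' r₁' φ
        ≤ arcCurvature r₁' r₂ φ + arcCurvature r₂ r₁' φ := by
          simpa only [add_comm] using hsnd.antitoneOn hr₂ hr₂' hle.2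
      _ < arcCurvature r₁ r₂ φ + arcCurvature r₂ r₁ φ := hfst hr₁ hr₁' h₁
  · simpa only [add_comm] using hsnd hr₂ hr₂' (Prod.mk_lt_mk_iff_right.1 hlt)

lemma cot_div_two {x : ℝ} (hx : sin (x / 2) ≠ 0) : cot (x / 2) = (1 + cos x) / sin x := by
  obtain ⟨y, rfl⟩ : ∃ y, x = 2 * y := ⟨x / 2, by ring⟩
  rw [mul_div_cancel_left₀ y two_ne_zero] at hx ⊢
  rw [cos_two_mul, sin_two_mul, cot_eq_cos_div_sin]
  rcases eq_or_ne (cos y) 0 with hy | hy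
  · simp only [hy]
    norm_num
  · field_simp
    ring

lemma tendsto_arcCurvature_diag (hφ : φ ∈ Ioo 0 π) :
    Tendsto (fun r => arcCurvature r r φ + arcCurvature r r φ) (𝓝[>] 0) (𝓝 (2 * φ)) := by
  have hhalf : φ / 2 ∈ Ioo 0 π := ⟨half_pos hφ.1, (half_lt_self hφ.1).trans hφ.2⟩
  have hlim : Tendsto (fun r => 4 * (π / 2 - arctan (cos r * cot (φ / 2))) * cos r) (𝓝[>] 0)
      (𝓝 (2 * φ)) := by
    have hcts : Continuous fun r => 4 * (π / 2 - arctan (cos r * cot (φ / 2))) * cos r := by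
      fun_prop
    refine (hcts.tendsto' 0 (2 * φ) ?_).mono_left nhdsWithin_le_nhds
    rw [cos_zero, one_mul, pi_div_two_sub_arctan_cot hhalf]
    ring
  refine hlim.congr' ?_
  filter_upwards [Ioo_mem_nhdsGT pi_pos] with r hr
  have hsin := (sin_pos_of_mem_Ioo hr).ne'
  have hcotHalf : cotHalfAngle r r φ = cos r * cot (φ / 2) := by
    rw [cotHalfAngle, cot_eq_cos_div_sin r, mul_div_cancel₀ _ hsin,
      cot_div_two (sin_pos_of_mem_Ioo hhalf).ne']
    ring
  rw [arcCurvature, halfAngle, hcotHalf]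
  ring

lemma arcCurvature_add_lt (hφ : φ ∈ Ioo 0 π) (hr₁ : r₁ ∈ Ioo 0 π) (hr₂ : r₂ ∈ Ioo 0 π) :
    arcCurvature r₁ r₂ φ + arcCurvature r₂ r₁ φ < 2 * φ := by
  have hanti := strictAntiOn_arcCurvature_add hφ
  have hmem : ∀ {r}, 0 < r → r < min r₁ r₂ → r ∈ Ioo 0 π :=
    fun h₀ h => ⟨h₀, (h.trans_le (min_le_left _ _)).trans hr₁.2⟩
  obtain ⟨r, hr₀, hr⟩ := exists_between (lt_min hr₁.1 hr₂.1)
  have hr' := hmem hr₀ hr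
  have hlt : (r, r) < (r₁, r₂) :=
    Prod.mk_lt_mk_of_lt_of_le (hr.trans_le (min_le_left _ _)) (hr.le.trans (min_le_right _ _))
  refine (hanti ⟨hr', hr'⟩ ⟨hr₁, hr₂⟩ hlt).trans_le
    (ge_of_tendsto (tendsto_arcCurvature_diag hφ) ?_)
  filter_upwards [Ioo_mem_nhdsGT hr₀] with x hx
  have hx' := hmem hx.1 (hx.2.trans hr)
  have hle : (x, x) ≤ (r, r) := Prod.mk_le_mk.2 ⟨hx.2.le, hx.2.le⟩
  exact (hanti.antitoneOn ⟨hx', hx'⟩ ⟨hr', hr'⟩ hle :)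

lemma tendsto_arcCurvature_add (hφ : φ ∈ Ioo 0 π) :
    Tendsto (fun p : ℝ × ℝ => arcCurvature p.1 p.2 φ + arcCurvature p.2 p.1 φ)
      (𝓝[Ioo 0 π ×ˢ Ioo 0 π] (0, 0)) (𝓝 (2 * φ)) := by
  have hmax : Tendsto (fun p : ℝ × ℝ => max p.1 p.2) (𝓝[Ioo 0 π ×ˢ Ioo 0 π] (0, 0)) (𝓝[>] 0) := by
    refine tendsto_nhdsWithin_iff.2 ⟨?_, ?_⟩
    · have hcts : Continuous fun p : ℝ × ℝ => max p.1 p.2 := by fun_prop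
      exact (hcts.tendsto' _ _ (max_self 0)).mono_left nhdsWithin_le_nhds
    · filter_upwards [self_mem_nhdsWithin] with p hp using lt_max_of_lt_left hp.1.1
  refine tendsto_of_tendsto_of_tendsto_of_le_of_le' ((tendsto_arcCurvature_diag hφ).comp hmax)
    tendsto_const_nhds ?_ ?_ <;> filter_upwards [self_mem_nhdsWithin] with p hp
  · have hm : max p.1 p.2 ∈ Ioo 0 π := ⟨lt_max_of_lt_left hp.1.1, max_lt hp.1.2 hp.2.2⟩
    have hle : p ≤ (max p.1 p.2, max p.1 p.2) := ⟨le_max_left _ _, le_max_right _ _⟩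
    exact ((strictAntiOn_arcCurvature_add hφ).antitoneOn hp ⟨hm, hm⟩ hle :)
  · exact (arcCurvature_add_lt hφ hp.1 hp.2).le

end Bigon

section Geometry

variable {r₁ r₂ φ : ℝ}

lemma volume_setOf_cos_lt_cos {θ : ℝ} (hθ : θ ∈ Ico 0 π) :
    MeasureTheory.volume {τ : ℝ | τ ∈ Ioc (-π) π ∧ cos θ < cos τ} = ENNReal.ofReal (2 * θ) := by
  have hset : {τ : ℝ | τ ∈ Ioc (-π) π ∧ cos θ < cos τ} = Ioo (-θ) θ := by
    ext τ
    constructor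
    · rintro ⟨hτ, hcos⟩
      by_contra hle
      rw [mem_Ioo, ← abs_lt, not_lt] at hle
      rw [← cos_abs τ] at hcos
      exact hcos.not_ge (cos_le_cos_of_nonneg_of_le_pi hθ.1 (abs_le.2 ⟨hτ.1.le, hτ.2⟩) hle)
    · intro hτ
      refine ⟨⟨by linarith [hτ.1, hθ.2], by linarith [hτ.2, hθ.2]⟩, ?_⟩
      rw [← cos_abs τ]
      exact cos_lt_cos_of_nonneg_of_le_pi (abs_nonneg τ) hθ.2.le (abs_lt.2 hτ)
  rw [hset, Real.volume_Ioo, sub_neg_eq_add, two_mul]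

lemma norm_circlePoint (r τ : ℝ) : ‖circlePoint r τ‖ = 1 := by
  rw [EuclideanSpace.norm_eq, sqrt_eq_one]
  simp only [circlePoint, Fin.sum_univ_three, Real.norm_eq_abs, sq_abs, Matrix.cons_val]
  linear_combination sin r ^ 2 * sin_sq_add_cos_sq τ + sin_sq_add_cos_sq r

lemma inner_circlePoint_zero (d r τ : ℝ) :
    inner ℝ (circlePoint d 0) (circlePoint r τ) = sin d * sin r * cos τ + cos d * cos r := by
  simp only [circlePoint, PiLp.inner_apply, Fin.sum_univ_three, Matrix.cons_val, cos_zero,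
    sin_zero, RCLike.inner_apply, conj_trivial]
  ring

lemma circlePoint_mem_sphericalDisk_iff {d τ : ℝ} (hr₂ : r₂ ∈ Icc 0 π) :
    circlePoint r₁ τ ∈ sphericalDisk (circlePoint d 0) r₂ ↔
      cos r₂ < sin d * sin r₁ * cos τ + cos d * cos r₁ := by
  have hangle : cos (InnerProductGeometry.angle (circlePoint d 0) (circlePoint r₁ τ)) =
      sin d * sin r₁ * cos τ + cos d * cos r₁ := by
    rw [InnerProductGeometry.cos_angle, norm_circlePoint, norm_circlePoint, mul_one, div_one,
      inner_circlePoint_zero]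
  rw [← hangle, strictAntiOn_cos.lt_iff_gt hr₂
    ⟨InnerProductGeometry.angle_nonneg _ _, InnerProductGeometry.angle_le_pi _ _⟩]
  exact and_iff_right (norm_circlePoint r₁ τ)

lemma cos_centerDist (r₁ : ℝ) (hr₂ : sin r₂ ≠ 0) (hφ : sin φ ≠ 0) :
    cos (centerDist r₁ r₂ φ) = cos r₁ * cos r₂ - sin r₁ * sin r₂ * cos φ := by
  have hsq : (cos r₁ * cos r₂ - sin r₁ * sin r₂ * cos φ) ^ 2 ≤ 1 :=
    sub_nonneg.1 (sq_mul_one_add_cotHalfAngle_sq r₁ hr₂ hφ ▸ by positivity)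
  have habs := abs_le.1 ((sq_le_one_iff_abs_le_one _).1 hsq)
  rw [centerDist, cos_pi_sub, mul_neg, ← sub_eq_add_neg, cos_arccos habs.1 habs.2]

lemma sin_centerDist (r₁ : ℝ) (hr₂ : r₂ ∈ Ioo 0 π) (hφ : φ ∈ Ioo 0 π) :
    sin (centerDist r₁ r₂ φ) = sin r₂ * sin φ * √(1 + cotHalfAngle r₁ r₂ φ ^ 2) := by
  have hr₂_sin := sin_pos_of_mem_Ioo hr₂
  have hφ_sin := sin_pos_of_mem_Ioo hφ
  rw [centerDist, cos_pi_sub, mul_neg, ← sub_eq_add_neg, sin_arccos,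
    ← sq_mul_one_add_cotHalfAngle_sq r₁ hr₂_sin.ne' hφ_sin.ne', sqrt_mul (sq_nonneg _),
    sqrt_sq (by positivity)]

/-- The spherical law of cosines in the triangle of the two centers and a vertex of the bigon, for
the angle at the first center. -/
lemma cos_eq_sin_centerDist_mul_cos_halfAngle (r₁ : ℝ) (hr₂ : r₂ ∈ Ioo 0 π) (hφ : φ ∈ Ioo 0 π) :
    cos r₂ = sin (centerDist r₁ r₂ φ) * sin r₁ * cos (halfAngle r₁ r₂ φ) +
      cos (centerDist r₁ r₂ φ) * cos r₁ := by
  have hr₂_sin := (sin_pos_of_mem_Ioo hr₂).ne'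
  have hφ_sin := (sin_pos_of_mem_Ioo hφ).ne'
  have hsqrt : √(1 + cotHalfAngle r₁ r₂ φ ^ 2) ≠ 0 := by positivity
  have hproj : sin (centerDist r₁ r₂ φ) * cos (halfAngle r₁ r₂ φ) =
      sin r₁ * cos r₂ + cos r₁ * sin r₂ * cos φ :=
    calc sin (centerDist r₁ r₂ φ) * cos (halfAngle r₁ r₂ φ)
        = sin r₂ * sin φ * cotHalfAngle r₁ r₂ φ := by
          rw [sin_centerDist r₁ hr₂ hφ, cos_halfAngle]
          field_simp
      _ = sin r₁ * cos r₂ + cos r₁ * sin r₂ * cos φ := by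
          rw [cotHalfAngle, cot_eq_cos_div_sin]
          field_simp
  rw [cos_centerDist r₁ hr₂_sin hφ_sin]
  linear_combination -sin r₁ * hproj - cos r₂ * sin_sq_add_cos_sq r₁

lemma centralAngle_eq (hr₁ : r₁ ∈ Ioo 0 π) (hr₂ : r₂ ∈ Ioo 0 π) (hφ : φ ∈ Ioo 0 π) :
    centralAngle r₁ r₂ φ = 2 * halfAngle r₁ r₂ φ := by
  have hsin : 0 < sin (centerDist r₁ r₂ φ) * sin r₁ := by
    have := sin_pos_of_mem_Ioo hr₁
    have := sin_pos_of_mem_Ioo hr₂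
    have := sin_pos_of_mem_Ioo hφ
    rw [sin_centerDist r₁ hr₂ hφ]
    positivity
  have hiff : ∀ τ, circlePoint r₁ τ ∈ secondDisk r₁ r₂ φ ↔
      cos (halfAngle r₁ r₂ φ) < cos τ := fun τ => by
    rw [secondDisk, circlePoint_mem_sphericalDisk_iff (Ioo_subset_Icc_self hr₂),
      cos_eq_sin_centerDist_mul_cos_halfAngle r₁ hr₂ hφ, add_lt_add_iff_right,
      mul_lt_mul_iff_right₀ hsin]
  have hθ := halfAngle_pos r₁ r₂ φ
  simp only [centralAngle, hiff]
  rw [volume_setOf_cos_lt_cos ⟨hθ.le, halfAngle_lt_pi r₁ r₂ φ⟩,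
    ENNReal.toReal_ofReal (by positivity)]

lemma bigonSideLength_mul_cot (hr₁ : r₁ ∈ Ioo 0 π) (hr₂ : r₂ ∈ Ioo 0 π) (hφ : φ ∈ Ioo 0 π) :
    bigonSideLength r₁ r₂ φ * cot r₁ = arcCurvature r₁ r₂ φ := by
  rw [bigonSideLength, centralAngle_eq hr₁ hr₂ hφ, arcCurvature, cot_eq_cos_div_sin, mul_assoc,
    mul_div_cancel₀ _ (sin_pos_of_mem_Ioo hr₁).ne']

end Geometry

section Isotopy

variable {X Y Z : Type*} [TopologicalSpace X] [TopologicalSpace Y] [TopologicalSpace Z]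

lemma isotopic_iff_homotopicWith {g h : X ≃ₜ Y} :
    Isotopic g h ↔
      ContinuousMap.HomotopicWith (g : C(X, Y)) (h : C(X, Y)) fun f => IsHomeomorph f := by
  constructor
  · rintro ⟨H, hH, rfl, rfl⟩
    exact ⟨⟨⟨⟨_, hH⟩, fun _ => rfl, fun _ => rfl⟩, fun t => (H t).isHomeomorph⟩⟩
  · rintro ⟨H⟩
    refine ⟨fun t => (H.prop t).homeomorph _, H.continuous, ?_, ?_⟩
    · ext x
      exact H.apply_zero x
    · ext x
      exact H.apply_one x

lemma Isotopic.refl (g : X ≃ₜ Y) : Isotopic g g :=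
  isotopic_iff_homotopicWith.2 (.refl _ g.isHomeomorph)

lemma Isotopic.symm {g h : X ≃ₜ Y} (hgh : Isotopic g h) : Isotopic h g :=
  isotopic_iff_homotopicWith.2 (isotopic_iff_homotopicWith.1 hgh).symm

lemma Isotopic.trans {g h k : X ≃ₜ Y} (hgh : Isotopic g h) (hhk : Isotopic h k) : Isotopic g k :=
  isotopic_iff_homotopicWith.2
    ((isotopic_iff_homotopicWith.1 hgh).trans (isotopic_iff_homotopicWith.1 hhk))

lemma Isotopic.comp_left {g h : Y ≃ₜ Z} (k : X ≃ₜ Y) :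
    Isotopic g h → Isotopic (k.trans g) (k.trans h) := by
  rintro ⟨H, hH, rfl, rfl⟩
  exact ⟨fun t => k.trans (H t), hH.comp (continuous_id.prodMap k.continuous), rfl, rfl⟩

end Isotopy

namespace CirclePatternMetric

variable {S E F : Type*} [TopologicalSpace S] {C : CellularDecomposition S E F} {Φ : E → ℝ}

lemma isIsometric_of_radius_eq {μ₁ μ₂ : CirclePatternMetric C Φ} (h : μ₁.radius = μ₂.radius) :
    μ₁.IsIsometric μ₂ := by
  have hiso : Isotopic (μ₁.marking.symm.trans μ₂.marking) (Homeomorph.refl S) := by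
    simpa only [Homeomorph.symm_trans_self] using
      (μ₂.isotopic.trans μ₁.isotopic.symm).comp_left μ₁.marking.symm
  refine ⟨_, hiso, fun x y => ?_, fun s => ?_, congrFun h⟩
  · obtain ⟨p, rfl⟩ := μ₁.marking.surjective x
    obtain ⟨q, rfl⟩ := μ₁.marking.surjective y
    simp only [Homeomorph.trans_apply, Homeomorph.symm_apply_apply, dist_eq, h]
  · simp only [Homeomorph.trans_apply, Homeomorph.symm_apply_apply]

/-- The circle pattern metric with given radii, on the given cellular decomposition itself. -/
noncomputable def ofRadius (C : CellularDecomposition S E F) (Φ : E → ℝ) (r : F → ℝ)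
    (hr : ∀ f, r f ∈ Ioo 0 (π / 2)) : CirclePatternMetric C Φ where
  dist x y := C.toCellData.gluedDist Φ r (C.homeo.symm x) (C.homeo.symm y)
  radius := r
  radius_mem := hr
  marking := C.homeo
  isotopic := .refl _
  dist_eq p q := by simp only [Homeomorph.symm_apply_apply]

end CirclePatternMetric

namespace CellData

variable {E F : Type*} (C : CellData E F) {Φ : E → ℝ} {r : F → ℝ} {F' : Finset F} {e : E}

/-- The contribution of the side `s` to the total geodesic curvature of `face s`, in closed form. -/
noncomputable def sideCurvature (Φ : E → ℝ) (r : F → ℝ) (s : E × Bool) : ℝ :=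
  arcCurvature (r (C.face s)) (r (C.face (opposite s))) (Φ s.1)

/-- The total geodesic curvature of the 2-cell `f`, in closed form. -/
noncomputable def faceCurvature [Fintype E] (Φ : E → ℝ) (r : F → ℝ) (f : F) : ℝ :=
  open Classical in
  ∑ s : E × Bool with C.face s = f, C.sideCurvature Φ r s

/-- The part of the curvature of the bigon at the 1-cell `e` that belongs to 2-cells in `F'`. -/
noncomputable def edgeCurvature (Φ : E → ℝ) (r : F → ℝ) (F' : Finset F) (e : E) : ℝ :=
  open Classical in
  ∑ b : Bool with C.face (e, b) ∈ F', C.sideCurvature Φ r (e, b)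

lemma mem_edgesOf [Fintype E] : e ∈ C.edgesOf F' ↔ ∃ b, C.face (e, b) ∈ F' := by
  simp only [edgesOf, Finset.mem_filter_univ]

lemma totalGeodesicCurvature_eqOn [Fintype E] (hΦ : ∀ e, Φ e ∈ Ioo 0 π) :
    EqOn (C.totalGeodesicCurvature Φ) (C.faceCurvature Φ) (univ.pi fun _ => Ioo 0 π) :=
  fun _ hr => funext fun _ => Finset.sum_congr rfl fun s _ =>
    bigonSideLength_mul_cot (hr _ trivial) (hr _ trivial) (hΦ s.1)

lemma edgeCurvature_of_forall_mem (h : ∀ b, C.face (e, b) ∈ F') :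
    C.edgeCurvature Φ r F' e = ∑ b, C.sideCurvature Φ r (e, b) := by
  simp only [edgeCurvature, h, Finset.filter_true]

lemma edgeCurvature_of_notMem {b : Bool} (hb : C.face (e, b) ∈ F')
    (hb' : C.face (e, !b) ∉ F') : C.edgeCurvature Φ r F' e = C.sideCurvature Φ r (e, b) := by
  have hfilter : ∀ b', C.face (e, b') ∈ F' ↔ b' = b := fun b' => by
    rcases Bool.eq_or_eq_not b' b with rfl | rfl
    · simp only [hb]
    · simp only [hb', Bool.not_eq_self]
  simp only [edgeCurvature, hfilter, Finset.filter_eq', Finset.mem_univ, if_true,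
    Finset.sum_singleton]

lemma sum_faceCurvature [Fintype E] (Φ : E → ℝ) (r : F → ℝ) (F' : Finset F) :
    ∑ f ∈ F', C.faceCurvature Φ r f = ∑ e ∈ C.edgesOf F', C.edgeCurvature Φ r F' e := by
  classical
  calc ∑ f ∈ F', C.faceCurvature Φ r f
      = ∑ s : E × Bool, if C.face s ∈ F' then C.sideCurvature Φ r s else 0 := by
        simp only [faceCurvature, Finset.sum_filter]
        rw [Finset.sum_comm]
        simp only [Finset.sum_ite_eq]
    _ = ∑ e, C.edgeCurvature Φ r F' e := by
        simp only [Fintype.sum_prod_type, edgeCurvature, Finset.sum_filter]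
    _ = ∑ e ∈ C.edgesOf F', C.edgeCurvature Φ r F' e := by
        refine (Finset.sum_subset (Finset.subset_univ _) fun e _ he => ?_).symm
        rw [mem_edgesOf, not_exists] at he
        simp only [edgeCurvature, he, Finset.filter_false, Finset.sum_empty]

lemma sum_sideCurvature_lt (hΦ : Φ e ∈ Ioo 0 π) (hr : ∀ f, r f ∈ Ioo 0 π) :
    ∑ b, C.sideCurvature Φ r (e, b) < 2 * Φ e := by
  rw [Fintype.sum_bool]
  exact arcCurvature_add_lt hΦ (hr _) (hr _)

lemma edgeCurvature_lt (hΦ : Φ e ∈ Ioo 0 π) (hr : ∀ f, r f ∈ Ioo 0 (π / 2)) :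
    C.edgeCurvature Φ r F' e < 2 * Φ e := by
  classical
  have hr' : ∀ f, r f ∈ Ioo 0 π := fun f => ⟨(hr f).1, by linarith [(hr f).2, pi_pos]⟩
  exact (Finset.sum_le_sum_of_subset_of_nonneg (Finset.filter_subset _ _)
    fun b _ _ => (arcCurvature_pos (hr _)).le).trans_lt (C.sum_sideCurvature_lt hΦ hr')

lemma faceCurvature_pos [Fintype E] {f : F} (hf : r f ∈ Ioo 0 (π / 2)) :
    0 < C.faceCurvature Φ r f := by
  classical
  obtain ⟨s, hs⟩ := C.face_surjective f
  refine Finset.sum_pos (fun s hs => arcCurvature_pos ?_) ⟨s, (Finset.mem_filter_univ s).2 hs⟩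
  rwa [(Finset.mem_filter_univ s).1 hs]

lemma faceCurvature_eq_zero [Fintype E] {f : F} (hf : r f = π / 2) :
    C.faceCurvature Φ r f = 0 := by
  classical
  refine Finset.sum_eq_zero fun s hs => ?_
  rw [sideCurvature, (Finset.mem_filter_univ s).1 hs, hf, arcCurvature_pi_div_two]

lemma faceCurvature_mem_admissible [Fintype E] (hΦ : ∀ e, Φ e ∈ Ioo 0 π)
    (hr : ∀ f, r f ∈ Ioo 0 (π / 2)) : C.faceCurvature Φ r ∈ C.admissible Φ := by
  refine ⟨fun f => C.faceCurvature_pos (hr f), fun F' ⟨f, hf⟩ => ?_⟩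
  obtain ⟨⟨e, b⟩, rfl⟩ := C.face_surjective f
  rw [sum_faceCurvature, Finset.mul_sum]
  exact Finset.sum_lt_sum_of_nonempty ⟨e, C.mem_edgesOf.2 ⟨b, hf⟩⟩
    fun e _ => C.edgeCurvature_lt (hΦ e) hr

lemma offDiagMonotoneOn_faceCurvature [Fintype E] (hΦ : ∀ e, Φ e ∈ Ioo 0 π) :
    OffDiagMonotoneOn (C.faceCurvature Φ) (univ.pi fun _ => Ioc 0 (π / 2)) := by
  classical
  intro r hr r' hr' hle f hf
  have hπ : ∀ {x : F → ℝ}, x ∈ univ.pi (fun _ => Ioc 0 (π / 2)) → ∀ g, x g ∈ Ioo 0 π :=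
    fun hx g => ⟨(hx g trivial).1, by linarith [(hx g trivial).2, pi_pos]⟩
  refine Finset.sum_le_sum fun s hs => ?_
  rw [sideCurvature, sideCurvature, (Finset.mem_filter_univ s).1 hs, ← hf]
  exact arcCurvature_monotoneOn_right (hΦ s.1) (Ioc_subset_Icc_self (hr f trivial)) (hπ hr _)
    (hπ hr' _) (hle _)

lemma sum_sideCurvature_strictAntiOn [Fintype E] (hΦ : ∀ e, Φ e ∈ Ioo 0 π) :
    StrictAntiOn (fun r => ∑ s, C.sideCurvature Φ r s) (univ.pi fun _ => Ioo 0 π) := by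
  intro r hr r' hr' hlt
  obtain ⟨hle, f, hf⟩ := Pi.lt_def.1 hlt
  obtain ⟨⟨e, b⟩, rfl⟩ := C.face_surjective f
  let p (x : F → ℝ) (e : E) : ℝ × ℝ := (x (C.face (e, true)), x (C.face (e, false)))
  have hp : ∀ x ∈ univ.pi fun _ => Ioo 0 π, ∀ e, p x e ∈ Ioo 0 π ×ˢ Ioo 0 π :=
    fun x hx e => ⟨hx _ trivial, hx _ trivial⟩
  have hple : ∀ e, p r e ≤ p r' e := fun e => ⟨hle _, hle _⟩
  have hplt : p r e < p r' e := by
    refine (hple e).lt_of_ne fun h => hf.ne ?_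
    cases b
    · exact congrArg Prod.snd h
    · exact congrArg Prod.fst h
  simp only [Fintype.sum_prod_type, Fintype.sum_bool]
  refine Finset.sum_lt_sum (fun e _ => ?_) ⟨e, Finset.mem_univ e, ?_⟩
  · exact ((strictAntiOn_arcCurvature_add (hΦ e)).antitoneOn (hp r hr e) (hp r' hr' e)
      (hple e) :)
  · exact (strictAntiOn_arcCurvature_add (hΦ e) (hp r hr e) (hp r' hr' e) hplt :)

lemma strictAntiOn_sum_faceCurvature [Fintype E] [Fintype F] (hΦ : ∀ e, Φ e ∈ Ioo 0 π) :
    StrictAntiOn (fun r => ∑ f, C.faceCurvature Φ r f) (univ.pi fun _ => Ioo 0 π) := by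
  classical
  have hfiber : ∀ r, ∑ f, C.faceCurvature Φ r f = ∑ s, C.sideCurvature Φ r s :=
    fun r => Finset.sum_fiberwise _ _ _
  simpa only [hfiber] using C.sum_sideCurvature_strictAntiOn hΦ

lemma continuousAt_sideCurvature {s : E × Bool} (hs : sin (r (C.face (opposite s))) ≠ 0) :
    ContinuousAt (fun r => C.sideCurvature Φ r s) r :=
  (continuousAt_arcCurvature _ _ hs).comp
    (f := fun r : F → ℝ => (r (C.face s), r (C.face (opposite s)))) (by fun_prop)

lemma continuousOn_faceCurvature [Fintype E] :
    ContinuousOn (C.faceCurvature Φ) (univ.pi fun _ => Ioo 0 π) :=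
  continuousOn_pi.2 fun _ => continuousOn_finsetSum _ fun _ _ _ hr =>
    (C.continuousAt_sideCurvature (sin_pos_of_mem_Ioo (hr _ trivial)).ne').continuousWithinAt

lemma tendsto_edgeCurvature [Fintype E] (hΦ : Φ e ∈ Ioo 0 π) (hr : ∀ f, r f ∈ Ico 0 π)
    (hF' : ∀ f, f ∈ F' ↔ r f = 0) (he : e ∈ C.edgesOf F') :
    Tendsto (fun r => C.edgeCurvature Φ r F' e) (𝓝[univ.pi fun _ => Ioo 0 π] r) (𝓝 (2 * Φ e)) := by
  obtain ⟨b, hb⟩ := C.mem_edgesOf.1 he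
  by_cases hb' : C.face (e, !b) ∈ F'
  · have hmem : ∀ b, C.face (e, b) ∈ F' := (Bool.forall_bool' b).2 ⟨hb, hb'⟩
    have hpair : Tendsto (fun r : F → ℝ => (r (C.face (e, true)), r (C.face (e, false))))
        (𝓝[univ.pi fun _ => Ioo 0 π] r) (𝓝[Ioo 0 π ×ˢ Ioo 0 π] (0, 0)) := by
      refine tendsto_nhdsWithin_iff.2 ⟨?_, ?_⟩
      · have hcts : Continuous fun r : F → ℝ => (r (C.face (e, true)), r (C.face (e, false))) := by
          fun_prop
        have hzero : (r (C.face (e, true)), r (C.face (e, false))) = (0, 0) :=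
          Prod.ext ((hF' _).1 (hmem true)) ((hF' _).1 (hmem false))
        exact (hcts.tendsto' r _ hzero).mono_left nhdsWithin_le_nhds
      · filter_upwards [self_mem_nhdsWithin] with r hr using ⟨hr _ trivial, hr _ trivial⟩
    simp only [C.edgeCurvature_of_forall_mem hmem, Fintype.sum_bool]
    exact ((tendsto_arcCurvature_add hΦ).comp hpair :)
  · have hpos : 0 < r (C.face (e, !b)) := (hr _).1.lt_of_ne' (mt (hF' _).2 hb')
    have hlim : C.sideCurvature Φ r (e, b) = 2 * Φ e := by
      rw [sideCurvature, (hF' _).1 hb, arcCurvature_zero_left _ hΦ]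
    have hcts : ContinuousAt (fun r => C.sideCurvature Φ r (e, b)) r :=
      C.continuousAt_sideCurvature (sin_pos_of_mem_Ioo ⟨hpos, (hr _).2⟩).ne'
    simp only [C.edgeCurvature_of_notMem hb hb']
    exact hlim ▸ hcts.tendsto.mono_left nhdsWithin_le_nhds

lemma tendsto_sum_faceCurvature [Fintype E] (hΦ : ∀ e, Φ e ∈ Ioo 0 π) (hr : ∀ f, r f ∈ Ico 0 π)
    (hF' : ∀ f, f ∈ F' ↔ r f = 0) :
    Tendsto (fun r => ∑ f ∈ F', C.faceCurvature Φ r f) (𝓝[univ.pi fun _ => Ioo 0 π] r)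
      (𝓝 (2 * ∑ e ∈ C.edgesOf F', Φ e)) := by
  simp only [sum_faceCurvature, Finset.mul_sum]
  exact tendsto_finsetSum _ fun e he => C.tendsto_edgeCurvature (hΦ e) hr hF' he

/-- Where some radii shrink to `0`, the total curvature of the 2-cells concerned tends to the bound
in `admissible`, so it exceeds that of `L` before the limit. -/
lemma isCompact_faceCurvature_le [Fintype E] (hΦ : ∀ e, Φ e ∈ Ioo 0 π) {L : F → ℝ}
    (hL : L ∈ C.admissible Φ) :
    IsCompact {r ∈ univ.pi fun _ => Ioc 0 (π / 2) | C.faceCurvature Φ r ≤ L} := by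
  classical
  have := Finite.of_surjective _ C.face_surjective
  have := Fintype.ofFinite F
  set K := {r ∈ univ.pi fun _ => Ioc 0 (π / 2) | C.faceCurvature Φ r ≤ L}
  have hKbox : K ⊆ univ.pi fun _ => Icc 0 (π / 2) :=
    fun r hr f _ => Ioc_subset_Icc_self (hr.1 f trivial)
  have hKpos : K ⊆ univ.pi fun _ => Ioo 0 π :=
    fun r hr f _ => ⟨(hr.1 f trivial).1, by linarith [(hr.1 f trivial).2, pi_pos]⟩
  refine (isCompact_univ_pi fun _ => isCompact_Icc).of_isClosed_subset
    (isClosed_of_closure_subset fun r hr => ?_) hKbox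
  have hrbox := closure_minimal hKbox (isClosed_set_pi fun _ _ => isClosed_Icc) hr
  have := mem_closure_iff_nhdsWithin_neBot.1 hr
  have hπ : ∀ f, r f ∈ Ico 0 π :=
    fun f => ⟨(hrbox f trivial).1, by linarith [(hrbox f trivial).2, pi_pos]⟩
  have hzero : ∀ f, r f ≠ 0 := by
    intro f hf
    let F' : Finset F := {f | r f = 0}
    have hmem : ∀ f, f ∈ F' ↔ r f = 0 := fun f => Finset.mem_filter_univ f
    have htend := (C.tendsto_sum_faceCurvature hΦ hπ hmem).mono_left (nhdsWithin_mono r hKpos)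
    refine (hL.2 F' ⟨f, (hmem f).2 hf⟩).not_ge (le_of_tendsto htend ?_)
    filter_upwards [self_mem_nhdsWithin] with x hx using Finset.sum_le_sum fun f _ => hx.2 f
  have hpos : ∀ f, 0 < r f := fun f => (hπ f).1.lt_of_ne' (hzero f)
  refine ⟨fun f _ => ⟨hpos f, (hrbox f trivial).2⟩, ?_⟩
  have htend := (C.continuousOn_faceCurvature (Φ := Φ) r fun f _ => ⟨hpos f, (hπ f).2⟩).mono hKpos
  exact le_of_tendsto htend (eventually_mem_nhdsWithin.mono fun x hx => hx.2)

lemma injOn_faceCurvature [Fintype E] (hΦ : ∀ e, Φ e ∈ Ioo 0 π) :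
    InjOn (C.faceCurvature Φ) (univ.pi fun _ => Ioc 0 (π / 2)) := by
  have := Finite.of_surjective _ C.face_surjective
  have := Fintype.ofFinite F
  refine (C.offDiagMonotoneOn_faceCurvature hΦ).injOn ?_
    ((C.strictAntiOn_sum_faceCurvature hΦ).mono ?_)
  · exact infClosed_pi fun _ _ => LinearOrder.infClosed _
  · exact pi_mono fun _ _ => Ioc_subset_Ioo_right (half_lt_self pi_pos)

lemma exists_faceCurvature_eq [Fintype E] (hΦ : ∀ e, Φ e ∈ Ioo 0 π) {L : F → ℝ}
    (hL : L ∈ C.admissible Φ) : ∃ r ∈ univ.pi fun _ => Ioo 0 (π / 2), C.faceCurvature Φ r = L := by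
  have := Finite.of_surjective _ C.face_surjective
  have hne : {r ∈ univ.pi fun _ => Ioc 0 (π / 2) | C.faceCurvature Φ r ≤ L}.Nonempty :=
    ⟨fun _ => π / 2, fun _ _ => right_mem_Ioc.2 pi_div_two_pos,
      fun f => (C.faceCurvature_eq_zero rfl).trans_le (hL.1 f).le⟩
  have hcont := C.continuousOn_faceCurvature (Φ := Φ) |>.mono
    (pi_mono fun _ _ => Ioc_subset_Ioo_right (half_lt_self pi_pos))
  obtain ⟨r, hr, rfl⟩ := (C.offDiagMonotoneOn_faceCurvature hΦ).exists_apply_eq hcont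
    (C.isCompact_faceCurvature_le hΦ hL) hne
  refine ⟨r, fun f _ => ⟨(hr f trivial).1, (hr f trivial).2.lt_of_ne fun hf => ?_⟩, rfl⟩
  exact (hL.1 f).ne' (C.faceCurvature_eq_zero hf)

lemma bijOn_totalGeodesicCurvature [Fintype E] (hΦ : ∀ e, Φ e ∈ Ioo 0 π) :
    BijOn (C.totalGeodesicCurvature Φ) (univ.pi fun _ => Ioo 0 (π / 2)) (C.admissible Φ) := by
  have hbij : BijOn (C.faceCurvature Φ) (univ.pi fun _ => Ioo 0 (π / 2)) (C.admissible Φ) :=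
    ⟨fun r hr => C.faceCurvature_mem_admissible hΦ fun f => hr f trivial,
      (C.injOn_faceCurvature hΦ).mono (pi_mono fun _ _ => Ioo_subset_Ioc_self),
      fun L hL => C.exists_faceCurvature_eq hΦ hL⟩
  exact hbij.congr ((C.totalGeodesicCurvature_eqOn hΦ).mono
    (pi_mono fun _ _ => Ioo_subset_Ioo_right (half_le_self pi_pos.le))).symm

end CellData

end CirclePattern

-- For `π / 2 < Φ e`, the angle of a bigon side at a center can reach `π`; the two triangles
-- glued along `e` then no longer fill the quadrilateral, but the arc lengths are still those
-- of the bigon.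
theorem theorem1p4_general {S E F : Type*} [TopologicalSpace S] [Fintype E]
    (C : CirclePattern.CellularDecomposition S E F)
    (Φ : E → ℝ) (hΦ : ∀ e, Φ e ∈ Set.Ioo 0 Real.pi) (L : F → ℝ) :
    ((∃ μ : CirclePattern.CirclePatternMetric C Φ, μ.totalGeodesicCurvature = L) ↔
      L ∈ C.toCellData.admissible Φ) ∧
    ∀ μ₁ μ₂ : CirclePattern.CirclePatternMetric C Φ,
      μ₁.totalGeodesicCurvature = L → μ₂.totalGeodesicCurvature = L → μ₁.IsIsometric μ₂ := by
  have hbij := C.toCellData.bijOn_totalGeodesicCurvature hΦ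
  have hradius (μ : CirclePattern.CirclePatternMetric C Φ) :
      μ.radius ∈ Set.univ.pi fun _ => Set.Ioo 0 (Real.pi / 2) := fun f _ => μ.radius_mem f
  refine ⟨⟨?_, fun hL => ?_⟩, fun μ₁ μ₂ h₁ h₂ => ?_⟩
  · rintro ⟨μ, rfl⟩
    exact hbij.mapsTo (hradius μ)
  · obtain ⟨r, hr, rfl⟩ := hbij.surjOn hL
    exact ⟨.ofRadius C Φ r fun f => hr f trivial, rfl⟩
  · exact CirclePattern.CirclePatternMetric.isIsometric_of_radius_eq
      (hbij.injOn (hradius μ₁) (hradius μ₂) (h₁.trans h₂.symm))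

theorem theorem1p4 {S E F : Type*} [TopologicalSpace S] [Fintype E]
    (C : CirclePattern.CellularDecomposition S E F)
    (Φ : E → ℝ) (hΦ : ∀ e, Φ e ∈ Set.Ioo 0 (Real.pi / 2)) (L : F → ℝ) :
    ((∃ μ : CirclePattern.CirclePatternMetric C Φ, μ.totalGeodesicCurvature = L) ↔
      L ∈ C.toCellData.admissible Φ) ∧
    ∀ μ₁ μ₂ : CirclePattern.CirclePatternMetric C Φ,
      μ₁.totalGeodesicCurvature = L → μ₂.totalGeodesicCurvature = L → μ₁.IsIsometric μ₂ :=
  theorem1p4_general C Φ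
    (fun e => Set.Ioo_subset_Ioo_right (half_le_self Real.pi_pos.le) (hΦ e)) L
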